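/- **Setting.** There are $N$ players, $K$ arms and $T$ rounds. In round $t$ a set $\mathcal P_t$ of players and a set $\mathcal A_t$ of arms are available; each available arm $a_j$ has a strict preference ranking $\succ_{j,t}$ of $\mathcal P_t$ and a capacity $c_j(t)\in\{0,1,2,\dots\}$. These data are fixed in advance and arbitrary, and are known to the platform at the beginning of the round. Mean rewards $\mu_{i,j}\in(0,1)$ are unknown to the platform, and for $p_i\in\mathcal P_t$ distinct arms $a_j,a_{j'}\in\mathcal A_t$ satisfy $\mu_{i,j}\ne\mu_{i,j'}$; put $\mu_{i,0}=0$. Let $T_i$ be the number of rounds in which $p_i$ is available, and let $\Delta$ be the minimum of $|\mu_{i,j}-\mu_{i,j'}|$ over all $t$, $p_i\in\mathcal P_t$ and distinct $a_j,a_{j'}\in\mathcal A_t$ (with $1/\Delta^2=0$ if there are none). A matching $m_t$ of round $t$ assigns to each $p_i\in\mathcal P_t$ an available arm or nothing ($m_t(i)=0$), respecting capacities. It is stable if there is no blocking pair $(p_i,a_j)\in\mathcal P_t\times\mathcal A_t$, that is, no pair such that $\mu_{i,j}>\mu_{i,m_t(i)}$ and $a_j$ either has a vacancy or prefers $p_i$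 to one of its matched players. Let $\underline m_t$ be the player-pessimal stable matching, the stable matching with $\mu_{i,\underline m_t(i)}\le\mu_{i,m(i)}$ for every stable $m$ and every $p_i\in\mathcal P_t$. In a round with matching $m_t$, each available player $p_i$ receives a reward $r_i(t)$ which, conditionally on the past and on $m_t$, is Bernoulli with mean $\mu_{i,m_t(i)}$ (so it is $0$ if $p_i$ is unmatched). The player-pessimal stable regret of $p_i$ is $$\underline R_i(T_i)=\sum_{t:\,p_i\in\mathcal P_t}\bigl(\mu_{i,\underline m_t(i)}-\mathbb E[r_i(t)]\bigr).$$ **AC-UCB.** In round $t$, let $t_i$ be the number of rounds up to and including $t$ in which $p_i$ is available, $T_{i,j}$ the number of earlier rounds in which $p_i$ was matched to $a_j$, and $\hat\mu_{i,j}$ the average of the rewards received in them. Put $\mathrm{UCB}_{i,j}=\hat\mu_{i,j}+\sqrt{\log t_i/T_{i,j}}$ if $T_{i,j}>0$ and $\mathrm{UCB}_{i,j}=+\infty$ if $T_{i,j}=0$. Every $p_i\in\mathcal P_t$ ranks the arms in $\mathcal A_t$ by decreasing $\mathrm{UCB}_{i,j}$, ties being broken arbitrarily (without knowledge of the rewards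 still to be drawn), and $m_t$ is the output of the player-proposing Gale–Shapley algorithm for these rankings and the arms' rankings and capacities. **Theorem.** Assume that all $T_i$ are comparable and that $K=\mathrm O(\log T_i)$. Then under AC-UCB the player-pessimal stable regret of every player $p_i$ satisfies $\underline R_i(T_i)=\mathrm O(NK\log T_i/\Delta^2)$. Precisely: for all $c_1,c_2\in\mathbb R$ there is a constant $C>0$, depending only on $c_1$ and $c_2$, such that in every setting as above with $T_j\le c_1T_{j'}$ for all players $p_j,p_{j'}$, every player $p_i$ with $K\le c_2\log T_i$ satisfies $$\underline R_i(T_i)\le C\,\frac{NK\log T_i}{\Delta^2}.$$ -/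

import Mathlib

open MeasureTheory ProbabilityTheory

noncomputable section

namespace SleepingBandits

/-- What the platform sees at the beginning of one round: the available players and arms, the
strict preference rankings of the arms (position in a ranking, a smaller position being better;
only the ranking of the available players matters) and the capacities of the arms. -/
structure Round (N K : ℕ) where
  players : Finset (Fin N)
  arms : Finset (Fin K)
  rank : Fin K → Equiv.Perm (Fin N)
  capacity : Fin K → ℕ

/-- An assignment of players to arms; `none` means unmatched. -/
abbrev Assignment (N K : ℕ) := Fin N → Option (Fin K)

/-- The mean reward of an assigned arm, with mean `0` for being unmatched. -/
def meanOf {K : ℕ} (μ : Fin K → ℝ) : Option (Fin K) → ℝ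
  | none => 0
  | some a => μ a

namespace Round

variable {N K : ℕ}

/-- Arm `a` prefers player `p` over player `q`. -/
def Prefers (R : Round N K) (a : Fin K) (p q : Fin N) : Prop := R.rank a p < R.rank a q

/-- The players matched to arm `a`. -/
def matchedTo (R : Round N K) (m : Assignment N K) (a : Fin K) : Finset (Fin N) :=
  R.players.filter fun p => m p = some a

/-- `m` matches only available players with available arms and respects the capacities. -/
structure IsMatching (R : Round N K) (m : Assignment N K) : Prop where
  available : ∀ p a, m p = some a → p ∈ R.players ∧ a ∈ R.arms
  capacity_le : ∀ a ∈ R.arms, (R.matchedTo m a).card ≤ R.capacity a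

/-- `(p, a)` is a blocking pair for `m`, the players' preferences being given by the means `μ`. -/
def IsBlockingPair (R : Round N K) (μ : Fin N → Fin K → ℝ) (m : Assignment N K)
    (p : Fin N) (a : Fin K) : Prop :=
  p ∈ R.players ∧ a ∈ R.arms ∧ meanOf (μ p) (m p) < μ p a ∧
    ((R.matchedTo m a).card < R.capacity a ∨ ∃ q ∈ R.matchedTo m a, R.Prefers a p q)

/-- Stable matchings with respect to the true preferences. -/
def IsStable (R : Round N K) (μ : Fin N → Fin K → ℝ) (m : Assignment N K) : Prop :=
  R.IsMatching m ∧ ∀ p a, ¬ R.IsBlockingPair μ m p a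

/-- The player-pessimal stable matching: a stable matching that is, for every available player,
weakly worse than every other stable matching. -/
def IsPlayerPessimal (R : Round N K) (μ : Fin N → Fin K → ℝ) (m : Assignment N K) : Prop :=
  R.IsStable μ m ∧ ∀ m', R.IsStable μ m' →
    ∀ p ∈ R.players, meanOf (μ p) (m p) ≤ meanOf (μ p) (m' p)

/-- State of the player-proposing Gale–Shapley algorithm: the set of free players, the arms to
which each player has already proposed, and the players currently held by each arm. -/
structure GSState (N K : ℕ) where
  free : Finset (Fin N)
  proposed : Fin N → Finset (Fin K)
  held : Fin K → Finset (Fin N)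

/-- Initially all available players are free, and there are neither proposals nor matches. -/
def gsInit (R : Round N K) : GSState N K where
  free := R.players
  proposed := fun _ => ∅
  held := fun _ => ∅

/-- `a` is the best available arm in `p`'s ranking `σ p` (position `0` is the best) to which `p`
has not proposed yet. -/
def IsNextArm (R : Round N K) (σ : Fin N → Equiv.Perm (Fin K)) (s : GSState N K)
    (p : Fin N) (a : Fin K) : Prop :=
  a ∈ R.arms ∧ a ∉ s.proposed p ∧ ∀ b ∈ R.arms, b ∉ s.proposed p → σ p a ≤ σ p b

/-- One pass through the loop of the player-proposing Gale–Shapley algorithm, for an arbitrary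
choice of the free player `p`. -/
inductive GSStep (R : Round N K) (σ : Fin N → Equiv.Perm (Fin K)) :
    GSState N K → GSState N K → Prop
  /-- `p` has proposed to every available arm and is removed from the free players. -/
  | exhausted (s : GSState N K) (p : Fin N) (hp : p ∈ s.free) (h : R.arms ⊆ s.proposed p) :
      GSStep R σ s { s with free := s.free.erase p }
  /-- `p` proposes to `a`, which has a vacancy and accepts. -/
  | vacancy (s : GSState N K) (p : Fin N) (a : Fin K) (hp : p ∈ s.free)
      (ha : R.IsNextArm σ s p a) (hc : (s.held a).card < R.capacity a) :
      GSStep R σ s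
        { free := s.free.erase p
          proposed := Function.update s.proposed p (insert a (s.proposed p))
          held := Function.update s.held a (insert p (s.held a)) }
  /-- `p` proposes to `a`, which is full and prefers `p` to its least preferred player `w`. -/
  | replace (s : GSState N K) (p : Fin N) (a : Fin K) (w : Fin N) (hp : p ∈ s.free)
      (ha : R.IsNextArm σ s p a) (hc : (s.held a).card = R.capacity a)
      (hw : w ∈ s.held a) (hworst : ∀ q ∈ s.held a, q ≠ w → R.Prefers a q w)
      (hpw : R.Prefers a p w) :
      GSStep R σ s
        { free := insert w (s.free.erase p)
          proposed := Function.update s.proposed p (insert a (s.proposed p))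
          held := Function.update s.held a (insert p ((s.held a).erase w)) }
  /-- `p` proposes to `a`, which is full and rejects `p`. -/
  | reject (s : GSState N K) (p : Fin N) (a : Fin K) (hp : p ∈ s.free)
      (ha : R.IsNextArm σ s p a) (hc : (s.held a).card = R.capacity a)
      (hrej : ∀ q ∈ s.held a, R.Prefers a q p) :
      GSStep R σ s
        { s with proposed := Function.update s.proposed p (insert a (s.proposed p)) }

/-- `m` is the matching returned by a run of the player-proposing Gale–Shapley algorithm on the
round `R` with the players' rankings `σ`. -/
def IsGSOutput (R : Round N K) (σ : Fin N → Equiv.Perm (Fin K)) (m : Assignment N K) : Prop :=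
  ∃ s : GSState N K, Relation.ReflTransGen (GSStep R σ) (gsInit R) s ∧ s.free = ∅ ∧
    ∀ p a, m p = some a ↔ p ∈ s.held a

end Round

/-- A sleeping competing bandits environment with `N` players, `K` arms and `T` rounds. The rounds
are numbered `0, …, T - 1`; `round t` is irrelevant for `t ≥ T`. -/
structure Environment (N K : ℕ) where
  T : ℕ
  round : ℕ → Round N K
  μ : Fin N → Fin K → ℝ
  μ_pos : ∀ i j, 0 < μ i j
  μ_lt_one : ∀ i j, μ i j < 1
  /-- No ties between arms that are available together. -/
  μ_distinct : ∀ t < T, ∀ i ∈ (round t).players, ∀ a ∈ (round t).arms, ∀ b ∈ (round t).arms,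
    a ≠ b → μ i a ≠ μ i b

namespace Environment

variable {N K : ℕ} (E : Environment N K)

/-- The set of rounds in which player `i` is available. -/
def availRounds (i : Fin N) : Finset ℕ :=
  (Finset.range E.T).filter fun t => i ∈ (E.round t).players

/-- `T_i`, the number of rounds in which player `i` is available. -/
def numRounds (i : Fin N) : ℕ := (E.availRounds i).card

/-- The local round index `t_i ∈ {1, …, T_i}` of a global round `t` in which `i` is available. -/
def localIndex (i : Fin N) (t : ℕ) : ℕ :=
  ((Finset.range (t + 1)).filter fun s => i ∈ (E.round s).players).card

/-- The minimum gap `Δ` between the means of two distinct arms that are available together, over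
all players and all rounds in which the player is available. (If there are no such arms, then
`Δ` is `0`, and `x / Δ ^ 2 = 0`, which is also its value for the convention `min ∅ = ∞`.) -/
def minGap : ℝ :=
  sInf {d : ℝ | ∃ t < E.T, ∃ i ∈ (E.round t).players, ∃ a ∈ (E.round t).arms,
    ∃ b ∈ (E.round t).arms, a ≠ b ∧ d = |E.μ i a - E.μ i b|}

variable {Ω : Type*}

/-- The rounds before round `t` in which player `i` was available and matched to arm `a`, when
`m s ω` is the matching of round `s`. -/
def matchRounds (m : ℕ → Ω → Assignment N K) (i : Fin N) (a : Fin K) (t : ℕ) (ω : Ω) :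
    Finset ℕ :=
  (Finset.range t).filter fun s => i ∈ (E.round s).players ∧ m s ω i = some a

/-- The number of matches between player `i` and arm `a` prior to round `t`. -/
def count (m : ℕ → Ω → Assignment N K) (i : Fin N) (a : Fin K) (t : ℕ) (ω : Ω) : ℕ :=
  (E.matchRounds m i a t ω).card

/-- The empirical mean of the rewards of arm `a` observed by player `i` prior to round `t`;
`r s i ω` is the reward of player `i` in round `s`. -/
def empMean (m : ℕ → Ω → Assignment N K) (r : ℕ → Fin N → Ω → ℝ)
    (i : Fin N) (a : Fin K) (t : ℕ) (ω : Ω) : ℝ :=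
  (∑ s ∈ E.matchRounds m i a t ω, r s i ω) / (E.count m i a t ω : ℝ)

/-- The UCB index of arm `a` for player `i` at round `t`. -/
def ucb (m : ℕ → Ω → Assignment N K) (r : ℕ → Fin N → Ω → ℝ)
    (i : Fin N) (a : Fin K) (t : ℕ) (ω : Ω) : EReal :=
  if E.count m i a t ω = 0 then ⊤
  else ((E.empMean m r i a t ω +
    Real.sqrt (Real.log (E.localIndex i t : ℝ) / (E.count m i a t ω : ℝ)) : ℝ) : EReal)

/-- `σ` ranks the available arms by their UCB indices at round `t` in descending order, for every
available player, with ties broken in any way. -/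
def IsUCBRanking (m : ℕ → Ω → Assignment N K) (r : ℕ → Fin N → Ω → ℝ) (t : ℕ) (ω : Ω)
    (σ : Fin N → Equiv.Perm (Fin K)) : Prop :=
  ∀ i ∈ (E.round t).players, ∀ a ∈ (E.round t).arms, ∀ b ∈ (E.round t).arms,
    σ i a < σ i b → E.ucb m r i b t ω ≤ E.ucb m r i a t ω

/-- The random matchings `m t` and rewards `r t i` arise from running AC-UCB in the environment.
`ℱ t` is the information at the beginning of round `t`. -/
structure IsACUCBRun [MeasurableSpace Ω] (P : Measure Ω) (ℱ : Filtration ℕ ‹MeasurableSpace Ω›)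
    (m : ℕ → Ω → Assignment N K) (r : ℕ → Fin N → Ω → ℝ) : Prop where
  /-- The platform runs Gale–Shapley on the UCB rankings. -/
  gale_shapley : ∀ t < E.T, ∀ ω, ∃ σ : Fin N → Equiv.Perm (Fin K),
    E.IsUCBRanking m r t ω σ ∧ (E.round t).IsGSOutput σ (m t ω)
  /-- The matching is chosen from the information available, before the rewards are drawn. -/
  adapted_matching : ∀ t < E.T, ∀ i a, MeasurableSet[ℱ t] {ω | m t ω i = some a}
  /-- The rewards of a round are known afterwards. -/
  adapted_reward : ∀ t < E.T, ∀ i ∈ (E.round t).players, Measurable[ℱ (t + 1)] (r t i)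
  /-- Rewards are `0` or `1`, and the conditional probability of `1` is the mean reward of the
  assigned arm: conditionally on the past and on the matching, a reward is a Bernoulli variable
  with this mean (and it vanishes almost surely for an unmatched player). -/
  reward_zero_one : ∀ t < E.T, ∀ i ∈ (E.round t).players, ∀ᵐ ω ∂P, r t i ω = 0 ∨ r t i ω = 1
  reward_mean : ∀ t < E.T, ∀ i ∈ (E.round t).players,
    P[r t i | ℱ t] =ᵐ[P] fun ω => meanOf (E.μ i) (m t ω i)

/-- The player-pessimal stable regret of player `i`, where `mPess t` is the player-pessimal
stable matching of round `t`. -/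
def pessimalRegret [MeasurableSpace Ω] (P : Measure Ω) (mPess : ℕ → Assignment N K)
    (r : ℕ → Fin N → Ω → ℝ) (i : Fin N) : ℝ :=
  ∑ t ∈ E.availRounds i, (meanOf (E.μ i) (mPess t i) - ∫ ω, r t i ω ∂P)

end Environment

end SleepingBandits

end

/-! A round costs player `i` nothing when its matching is stable for the true means, since the
pessimal stable matching is no better; otherwise it costs at most 1. So it suffices to count
unstable rounds.

Gale–Shapley is stable for the rankings it is given. A pair blocking for the true means can
therefore only come from a player `j` who ranks an arm `b` above a better arm `a`. Moreover, `j` is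
matched to `b` in that very round (`IsGSOutput.exists_of_isBlockingPair`), so each such mistake adds
a sample to the overrated arm. By the usual UCB argument (`rare_or_deviation`), either `j` has
sampled `b` at most `4 log T_j / Δ²` times, or a confidence interval of `j` fails. The first
alternative accounts for at most `4 log T_j / Δ² + 1` rounds per pair `(j, b)`.

For the second, the number of samples is random and the sampling adaptive, so the tail bound comes
from exponential supermartingales with mean at most 1 (`IsACUCBRun.expReward_spec`). Markov's
inequality and a union over the possible sample counts bound the failure probability by `2 / t_j`,
and the harmonic sum over the rounds of `j` gives `2 (1 + log T_j)`. Summing over all players and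
arms yields the factor `NK`; comparability of the `T_j` replaces `log T_j` by `log T_i` up to a
constant. -/

namespace SleepingBandits

/-! ### Gale–Shapley: only misranked matched arms cause instability -/

namespace Round

variable {N K : ℕ}

/-- The invariant of the Gale–Shapley loop. -/
structure GSInvariant (R : Round N K) (σ : Fin N → Equiv.Perm (Fin K)) (s : GSState N K) :
    Prop where
  free_players : s.free ⊆ R.players
  held_players : ∀ a, s.held a ⊆ R.players
  proposed_arms : ∀ p, s.proposed p ⊆ R.arms
  held_proposed : ∀ p a, p ∈ s.held a → a ∈ s.proposed p
  held_not_free : ∀ p a, p ∈ s.held a → p ∉ s.free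
  held_unique : ∀ p a b, p ∈ s.held a → p ∈ s.held b → a = b
  held_card : ∀ a, (s.held a).card ≤ R.capacity a
  settled : ∀ p ∈ R.players, p ∈ s.free ∨ (∃ a, p ∈ s.held a) ∨ R.arms ⊆ s.proposed p
  down_closed : ∀ p, ∀ a ∈ s.proposed p, ∀ b ∈ R.arms, σ p b < σ p a → b ∈ s.proposed p
  -- An arm that has turned a player away stays full, and its held players only improve.
  rejected : ∀ p a, a ∈ s.proposed p → p ∉ s.held a →
    (s.held a).card = R.capacity a ∧ ∀ q ∈ s.held a, R.Prefers a q p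

variable {R : Round N K} {σ : Fin N → Equiv.Perm (Fin K)}

theorem gsInvariant_gsInit : R.GSInvariant σ R.gsInit := by
  constructor <;> simp +contextual [gsInit]

theorem GSInvariant.down_closed_update {s : GSState N K} (h : R.GSInvariant σ s) {p : Fin N}
    {a : Fin K} (ha : R.IsNextArm σ s p a) (p' : Fin N) (c : Fin K)
    (hc : c ∈ Function.update s.proposed p (insert a (s.proposed p)) p') (b : Fin K)
    (hb : b ∈ R.arms) (hlt : σ p' b < σ p' c) :
    b ∈ Function.update s.proposed p (insert a (s.proposed p)) p' := by
  by_cases hp' : p' = p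
  · subst hp'
    simp only [Function.update_self, Finset.mem_insert] at hc ⊢
    rcases hc with rfl | hc
    · by_contra hcon
      push Not at hcon
      exact absurd (ha.2.2 b hb hcon.2) (not_le.2 hlt)
    · exact Or.inr (h.down_closed p' c hc b hb hlt)
  · rw [Function.update_of_ne hp'] at hc ⊢
    exact h.down_closed p' c hc b hb hlt

theorem GSInvariant.step {s s' : GSState N K} (h : R.GSInvariant σ s) (hs : GSStep R σ s s') :
    R.GSInvariant σ s' := by
  have hnf : ∀ p ∈ s.free, ∀ a, p ∉ s.held a := fun p hp a hpa => h.held_not_free p a hpa hp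
  cases hs with
  | exhausted p hp harms =>
    refine { h with free_players := ?_, held_not_free := ?_, settled := ?_ }
    · exact (Finset.erase_subset _ _).trans h.free_players
    · intro q a hq hq'
      exact h.held_not_free q a hq (Finset.mem_of_mem_erase hq')
    · intro q hq
      by_cases hqp : q = p
      · subst hqp; exact Or.inr (Or.inr harms)
      · simpa [hqp] using h.settled q hq
  | vacancy p a hp ha hc =>
    have hpa := hnf p hp
    have hpP := h.free_players hp
    refine ⟨?_, ?_, ?_, ?_, ?_, ?_, ?_, ?_, h.down_closed_update ha, ?_⟩
    · exact (Finset.erase_subset _ _).trans h.free_players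
    · intro b
      by_cases hb : b = a
      · subst hb
        simpa using Finset.insert_subset hpP (h.held_players b)
      · simpa [hb] using h.held_players b
    · intro q
      by_cases hq : q = p
      · subst hq
        simpa using Finset.insert_subset ha.1 (h.proposed_arms q)
      · simpa [hq] using h.proposed_arms q
    · intro q b hqb
      have := h.held_proposed q b
      simp only [Function.update_apply] at hqb ⊢
      grind
    · intro q b hqb
      have := h.held_not_free q b
      simp only [Function.update_apply] at hqb ⊢
      grind
    · intro q b c hqb hqc
      have := h.held_unique q b c
      simp only [Function.update_apply] at hqb hqc
      grind
    · intro b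
      have := h.held_card b
      simp only [Function.update_apply]
      split_ifs with hb
      · subst hb
        exact (Finset.card_insert_le _ _).trans hc
      · exact this
    · intro q hq
      have := h.settled q hq
      by_cases hqp : q = p
      · subst hqp
        exact Or.inr (Or.inl ⟨a, by simp⟩)
      · rcases this with h1 | ⟨b, hb⟩ | h1
        · exact Or.inl (by simp [hqp, h1])
        · refine Or.inr (Or.inl ⟨b, ?_⟩)
          simp only [Function.update_apply]
          grind
        · exact Or.inr (Or.inr (by simpa [hqp] using h1))
    · intro q b hqb hn
      have := h.rejected q b
      simp only [Function.update_apply] at hqb hn ⊢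
      by_cases hb : b = a
      · subst hb
        simp only [if_true, Finset.mem_insert, not_or] at hn
        rw [if_neg hn.1] at hqb
        -- An arm with a vacancy has not rejected anyone yet.
        exact absurd (this hqb hn.2).1 hc.ne
      · simp only [hb, if_false] at hn ⊢
        refine this ?_ hn
        grind
  | replace p a w hp ha hc hw hworst hpw =>
    have hpa := hnf p hp
    have hpP := h.free_players hp
    have hwp : w ≠ p := by rintro rfl; exact hpa a hw
    refine ⟨?_, ?_, ?_, ?_, ?_, ?_, ?_, ?_, h.down_closed_update ha, ?_⟩
    · exact Finset.insert_subset (h.held_players a hw)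
        ((Finset.erase_subset _ _).trans h.free_players)
    · intro b
      by_cases hb : b = a
      · subst hb
        simpa using Finset.insert_subset hpP
          ((Finset.erase_subset _ _).trans (h.held_players b))
      · simpa [hb] using h.held_players b
    · intro q
      by_cases hq : q = p
      · subst hq
        simpa using Finset.insert_subset ha.1 (h.proposed_arms q)
      · simpa [hq] using h.proposed_arms q
    · intro q b hqb
      have := h.held_proposed q b
      simp only [Function.update_apply] at hqb ⊢
      grind
    · intro q b hqb
      have := h.held_not_free q b
      have := h.held_unique q a b
      simp only [Function.update_apply] at hqb ⊢
      grind
    · intro q b c hqb hqc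
      have := h.held_unique q b c
      simp only [Function.update_apply] at hqb hqc
      grind
    · intro b
      have := h.held_card b
      simp only [Function.update_apply]
      split_ifs with hb
      · subst hb
        have h1 := Finset.card_insert_le p ((s.held b).erase w)
        have h2 := Finset.card_erase_add_one hw
        omega
      · exact this
    · intro q hq
      have := h.settled q hq
      by_cases hqp : q = p
      · subst hqp
        exact Or.inr (Or.inl ⟨a, by simp⟩)
      · by_cases hqw : q = w
        · exact Or.inl (by simp [hqw])
        rcases this with h1 | ⟨b, hb⟩ | h1
        · exact Or.inl (by simp [hqp, h1])
        · refine Or.inr (Or.inl ⟨b, ?_⟩)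
          simp only [Function.update_apply]
          grind
        · exact Or.inr (Or.inr (by simpa [hqp] using h1))
    · intro q b hqb hn
      have := h.rejected q b
      simp only [Function.update_apply] at hqb hn ⊢
      by_cases hb : b = a
      · subst hb
        simp only [if_true, Finset.mem_insert, Finset.mem_erase, not_or, not_and] at hn
        rw [if_neg hn.1] at hqb
        simp only [if_true]
        refine ⟨?_, ?_⟩
        · rw [Finset.card_insert_of_notMem (by simp [hpa]), Finset.card_erase_add_one hw, hc]
        -- Anyone beating the displaced `w` beats every rejected `q`: either `q = w`, or `w` was
        -- already preferred to `q`.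
        · have hwq : ∀ x, R.Prefers b x w → R.Prefers b x q := by
            intro x hx
            by_cases hqw : q = w
            · rwa [hqw]
            · exact lt_trans hx ((this hqb (hn.2 hqw)).2 w hw)
          intro x hx
          rcases Finset.mem_insert.1 hx with rfl | hx
          · exact hwq _ hpw
          · exact hwq _ (hworst x (Finset.mem_of_mem_erase hx) (Finset.ne_of_mem_erase hx))
      · simp only [hb, if_false] at hn ⊢
        refine this ?_ hn
        grind
  | reject p a hp ha hc hrej =>
    have hpa := hnf p hp
    refine { h with proposed_arms := ?_, held_proposed := ?_, settled := ?_,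
                    down_closed := h.down_closed_update ha, rejected := ?_ }
    · intro q
      by_cases hq : q = p
      · subst hq
        simpa using Finset.insert_subset ha.1 (h.proposed_arms q)
      · simpa [hq] using h.proposed_arms q
    · intro q b hqb
      have := h.held_proposed q b hqb
      simp only [Function.update_apply]
      grind
    · intro q hq
      have := h.settled q hq
      by_cases hqp : q = p
      · subst hqp; exact Or.inl hp
      · simpa [hqp] using this
    · intro q b hqb hn
      have := h.rejected q b
      simp only [Function.update_apply] at hqb hn ⊢
      by_cases hqp : q = p
      · subst hqp
        simp only [if_true, Finset.mem_insert] at hqb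
        rcases hqb with rfl | hqb
        · exact ⟨hc, hrej⟩
        · exact this hqb hn
      · rw [if_neg hqp] at hqb
        exact this hqb hn

/-- The invariant survives every choice of the proposing free player, so the order of proposals
never matters. -/
theorem gsInvariant_of_reflTransGen {s : GSState N K}
    (h : Relation.ReflTransGen (GSStep R σ) R.gsInit s) : R.GSInvariant σ s := by
  induction h with
  | refl => exact gsInvariant_gsInit
  | tail _ hs ih => exact ih.step hs

theorem IsGSOutput.isMatching {m : Assignment N K} (h : R.IsGSOutput σ m) : R.IsMatching m := by
  obtain ⟨s, hs, -, hm⟩ := h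
  have hinv := gsInvariant_of_reflTransGen hs
  refine ⟨fun p a hpa => ?_, fun a _ => ?_⟩
  · have hp := (hm p a).1 hpa
    exact ⟨hinv.held_players a hp, hinv.proposed_arms p (hinv.held_proposed p a hp)⟩
  · refine (Finset.card_le_card ?_).trans (hinv.held_card a)
    intro p hp
    exact (hm p a).1 (Finset.mem_filter.1 hp).2

/-- A blocking pair of a Gale–Shapley output consists of a matched player who ranks the assigned
arm above the arm of the pair. -/
theorem IsGSOutput.exists_of_isBlockingPair {m : Assignment N K} (h : R.IsGSOutput σ m)
    {μ : Fin N → Fin K → ℝ} {p : Fin N} {a : Fin K} (hb : R.IsBlockingPair μ m p a) :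
    ∃ b ∈ R.arms, m p = some b ∧ σ p b < σ p a ∧ μ p b < μ p a := by
  have hmat := h.isMatching
  obtain ⟨s, hs, hfree, hm⟩ := h
  have hinv := gsInvariant_of_reflTransGen hs
  obtain ⟨hp, ha, hlt, hblock⟩ := hb
  have hheld : R.matchedTo m a = s.held a := by
    ext q
    simp only [matchedTo, Finset.mem_filter, hm]
    exact ⟨fun h => h.2, fun h => ⟨hinv.held_players a h, h⟩⟩
  have hpa : p ∉ s.held a := by
    intro hpa
    rw [(hm p a).2 hpa] at hlt
    exact lt_irrefl _ hlt
  -- Had `p` proposed to `a`, the rejection would leave `a` full of players it prefers to `p`, which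
  -- excludes blocking.
  have hnot : a ∉ s.proposed p := by
    intro hprop
    obtain ⟨h1, h2⟩ := hinv.rejected p a hprop hpa
    rw [hheld] at hblock
    rcases hblock with h3 | ⟨q, hq, hpq⟩
    · exact h3.ne h1
    · exact lt_asymm hpq (h2 q hq)
  -- An unmatched player has exhausted all arms, contradicting `hnot`; so `p` is held by some `b`,
  -- reached before `a` in its ranking.
  rcases hinv.settled p hp with h1 | ⟨b, hpb⟩ | h1
  · simp [hfree] at h1
  · have hmb := (hm p b).2 hpb
    have hba : μ p b < μ p a := by rwa [hmb] at hlt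
    refine ⟨b, (hmat.available p b hmb).2, hmb, ?_, hba⟩
    have hprop := hinv.held_proposed p b hpb
    rcases lt_trichotomy (σ p b) (σ p a) with h1 | h1 | h1
    · exact h1
    · rw [(σ p).injective h1] at hba
      exact absurd hba (lt_irrefl _)
    · exact absurd (hinv.down_closed p b hprop a ha h1) hnot
  · exact absurd (h1 ha) hnot

end Round

end SleepingBandits

/-! ### Concentration of adaptively sampled rewards -/

noncomputable section

namespace SleepingBandits

/-- **Hoeffding's lemma** for a Bernoulli variable. -/
theorem one_add_mul_exp_sub_one_le {p : ℝ} (hp0 : 0 ≤ p) (hp1 : p ≤ 1) (l : ℝ) :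
    1 + (Real.exp l - 1) * p ≤ Real.exp (l * p + l ^ 2 / 8) := by
  have hint (f : ℝ → ℝ) : ∫ x, f x ∂(bernoulliMeasure (1 : ℝ) 0 ⟨p, hp0, hp1⟩)
      = p * f 1 + (1 - p) * f 0 := by
    simp [integral_bernoulliMeasure]
  have hb : ∀ᵐ x ∂(bernoulliMeasure (1 : ℝ) 0 ⟨p, hp0, hp1⟩), id x ∈ Set.Icc (0 : ℝ) 1 := by
    rw [bernoulliMeasure_def, ae_add_measure_iff]
    constructor <;> refine Measure.ae_smul_measure ?_ _ <;> simp [ae_dirac_eq]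
  -- A variable in an interval of length 1 has variance proxy `1/4`, whence `l ^ 2 / 8`; multiplying
  -- by `exp (l * p)` undoes the centering.
  have h := (hasSubgaussianMGF_of_mem_Icc aemeasurable_id hb).mgf_le l
  simp only [id, mgf] at h
  rw [hint, hint] at h
  simp only [mul_one, mul_zero, add_zero] at h
  have h2 := mul_le_mul_of_nonneg_left h (Real.exp_pos (l * p)).le
  have e1 : Real.exp (l * (1 - p)) = Real.exp l * Real.exp (-(l * p)) := by
    rw [← Real.exp_add]; ring_nf
  have e2 : Real.exp (l * (0 - p)) = Real.exp (-(l * p)) := by ring_nf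
  have e3 : Real.exp (l * p) * Real.exp (-(l * p)) = 1 := by
    rw [← Real.exp_add]; simp
  rw [e1, e2] at h2
  refine le_trans (le_of_eq ?_) (h2.trans (le_of_eq ?_))
  · linear_combination (-(p * Real.exp l + (1 - p))) * e3
  · rw [← Real.exp_add]
    congr 1
    norm_num
    ring

namespace Environment

variable {N K : ℕ} {E : Environment N K} {Ω : Type*}

theorem matchRounds_succ (m : ℕ → Ω → Assignment N K) (i : Fin N) (a : Fin K) (t : ℕ) (ω : Ω) :
    E.matchRounds m i a (t + 1) ω =
      if i ∈ (E.round t).players ∧ m t ω i = some a then insert t (E.matchRounds m i a t ω)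
      else E.matchRounds m i a t ω := by
  simp only [matchRounds, Finset.range_add_one, Finset.filter_insert]

theorem notMem_matchRounds (m : ℕ → Ω → Assignment N K) (i : Fin N) (a : Fin K) (t : ℕ) (ω : Ω) :
    t ∉ E.matchRounds m i a t ω := by
  simp [matchRounds]

variable (E) in
/-- The exponential supermartingale of the rewards that player `i` draws from arm `a`. -/
def expReward (m : ℕ → Ω → Assignment N K) (r : ℕ → Fin N → Ω → ℝ) (i : Fin N) (a : Fin K)
    (l : ℝ) (t : ℕ) (ω : Ω) : ℝ :=
  ∏ s ∈ E.matchRounds m i a t ω, Real.exp (l * (r s i ω - E.μ i a) - l ^ 2 / 8)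

theorem expReward_succ (m : ℕ → Ω → Assignment N K) (r : ℕ → Fin N → Ω → ℝ) (i : Fin N)
    (a : Fin K) (l : ℝ) (t : ℕ) (ω : Ω) :
    E.expReward m r i a l (t + 1) ω =
      if i ∈ (E.round t).players ∧ m t ω i = some a then
        E.expReward m r i a l t ω * Real.exp (l * (r t i ω - E.μ i a) - l ^ 2 / 8)
      else E.expReward m r i a l t ω := by
  simp only [expReward, matchRounds_succ]
  split_ifs
  · rw [Finset.prod_insert (E.notMem_matchRounds m i a t ω), mul_comm]
  · rfl

theorem expReward_eq (m : ℕ → Ω → Assignment N K) (r : ℕ → Fin N → Ω → ℝ) (i : Fin N)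
    (a : Fin K) (l : ℝ) (t : ℕ) (ω : Ω) :
    E.expReward m r i a l t ω = Real.exp (l * (∑ s ∈ E.matchRounds m i a t ω, r s i ω
      - E.count m i a t ω * E.μ i a) - E.count m i a t ω * (l ^ 2 / 8)) := by
  rw [expReward, ← Real.exp_sum]
  simp [Finset.sum_sub_distrib, ← Finset.mul_sum, count]

theorem expReward_pos (m : ℕ → Ω → Assignment N K) (r : ℕ → Fin N → Ω → ℝ) (i : Fin N)
    (a : Fin K) (l : ℝ) (t : ℕ) (ω : Ω) : 0 < E.expReward m r i a l t ω :=
  Finset.prod_pos fun _ _ => Real.exp_pos _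

variable (E) in
/-- The event that some deviation of the rewards drawn by player `i` from arm `a` leaves the
confidence interval in round `t`, expressed through the exponential supermartingales. -/
def deviationEvent (m : ℕ → Ω → Assignment N K) (r : ℕ → Fin N → Ω → ℝ) (i : Fin N)
    (a : Fin K) (t : ℕ) : Set Ω :=
  ⋃ n ∈ Finset.Icc 1 (E.localIndex i t - 1),
    ({ω | (E.localIndex i t : ℝ) ^ 2 ≤
        E.expReward m r i a (4 * √(Real.log (E.localIndex i t) / n)) t ω} ∪
      {ω | (E.localIndex i t : ℝ) ^ 2 ≤
        E.expReward m r i a (-(4 * √(Real.log (E.localIndex i t) / n))) t ω})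

theorem count_lt_localIndex {t : ℕ} {i : Fin N} (hi : i ∈ (E.round t).players)
    (m : ℕ → Ω → Assignment N K) (a : Fin K) (ω : Ω) :
    E.count m i a t ω < E.localIndex i t := by
  refine Finset.card_lt_card ⟨fun s hs => ?_, fun hsub => ?_⟩
  · simp only [matchRounds, Finset.mem_filter, Finset.mem_range] at hs ⊢
    exact ⟨by omega, hs.2.1⟩
  · have := hsub (Finset.mem_filter.2 ⟨Finset.mem_range.2 t.lt_succ_self, hi⟩)
    exact E.notMem_matchRounds m i a t ω this

/-- Outside of the deviation event, the empirical mean lies in the confidence interval. -/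
theorem abs_empMean_sub_le {m : ℕ → Ω → Assignment N K}
    {r : ℕ → Fin N → Ω → ℝ} {t : ℕ} {i : Fin N} (hi : i ∈ (E.round t).players)
    {a : Fin K} {ω : Ω} (hcount : E.count m i a t ω ≠ 0)
    (hω : ω ∉ E.deviationEvent m r i a t) :
    |E.empMean m r i a t ω - E.μ i a| ≤
      √(Real.log (E.localIndex i t) / E.count m i a t ω) := by
  by_contra! hcon
  apply hω
  set L := E.localIndex i t with hL
  set n := E.count m i a t ω with hn
  have hnL : n < L := E.count_lt_localIndex hi m a ω
  have hn0 : (0 : ℝ) < n := by exact_mod_cast Nat.pos_of_ne_zero hcount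
  have hL1 : (1 : ℝ) ≤ L := by exact_mod_cast (by omega : 1 ≤ L)
  have hlog : 0 ≤ Real.log L := Real.log_nonneg hL1
  set ρ := √(Real.log L / n) with hρ
  have hρ0 : 0 ≤ ρ := Real.sqrt_nonneg _
  have hρ2 : ρ ^ 2 * n = Real.log L := by
    rw [hρ, Real.sq_sqrt (by positivity)]
    field_simp
  have hsum : ∑ s ∈ E.matchRounds m i a t ω, r s i ω = E.empMean m r i a t ω * n := by
    rw [empMean, ← hn]
    field_simp
  have hLsq : (L : ℝ) ^ 2 = Real.exp (2 * (ρ ^ 2 * n)) := by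
    rw [hρ2, two_mul, Real.exp_add, Real.exp_log (by linarith)]
    ring
  -- The realized sample count selects the member of the union; it is below `L` because round `t`
  -- itself is counted in `L`.
  refine Set.mem_biUnion (x := n) (by simp; omega) ?_
  rw [← hL, ← hρ]
  rcases lt_abs.1 hcon with h1 | h1
  · left
    simp only [Set.mem_ofPred_eq]
    rw [expReward_eq, ← hn, hLsq, hsum, Real.exp_le_exp]
    -- The choice `l = 4ρ` maximizes `l * ρ - l ^ 2 / 8`, with value `2ρ²`; over `n` samples the
    -- exponent is at least `2nρ² = 2 log L`.
    nlinarith [mul_nonneg (mul_nonneg hρ0 hn0.le) (sub_nonneg.2 h1.le)]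
  · right
    simp only [Set.mem_ofPred_eq]
    rw [expReward_eq, ← hn, hLsq, hsum, Real.exp_le_exp]
    nlinarith [mul_nonneg (mul_nonneg hρ0 hn0.le) (sub_nonneg.2 h1.le)]

variable [MeasurableSpace Ω] {P : Measure Ω} [IsProbabilityMeasure P]
  {ℱ : Filtration ℕ ‹MeasurableSpace Ω›} {m : ℕ → Ω → Assignment N K} {r : ℕ → Fin N → Ω → ℝ}

theorem IsACUCBRun.integrable_reward (h : E.IsACUCBRun P ℱ m r) {t : ℕ} (ht : t < E.T)
    {i : Fin N} (hi : i ∈ (E.round t).players) : Integrable (r t i) P := by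
  refine Integrable.of_mem_Icc 0 1
    ((h.adapted_reward t ht i hi).mono (ℱ.le _) le_rfl).aemeasurable ?_
  filter_upwards [h.reward_zero_one t ht i hi] with ω hω
  rcases hω with hω | hω <;> simp [hω]

theorem IsACUCBRun.integral_mul_reward (h : E.IsACUCBRun P ℱ m r) {t : ℕ} (ht : t < E.T)
    {i : Fin N} (hi : i ∈ (E.round t).players) {g : Ω → ℝ} (hg : Measurable[ℱ t] g) {B : ℝ}
    (hB : ∀ᵐ ω ∂P, ‖g ω‖ ≤ B) :
    ∫ ω, g ω * r t i ω ∂P = ∫ ω, g ω * meanOf (E.μ i) (m t ω i) ∂P := by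
  have h1 := condExp_stronglyMeasurable_mul_of_bound (ℱ.le t) hg.stronglyMeasurable
    (h.integrable_reward ht hi) B hB
  rw [← integral_condExp (ℱ.le t) (f := fun ω => g ω * r t i ω)]
  refine integral_congr_ae ?_
  filter_upwards [h1, h.reward_mean t ht i hi] with ω h2 h3
  exact h2.trans (by simp [h3])

theorem IsACUCBRun.integral_reward (h : E.IsACUCBRun P ℱ m r) {t : ℕ} (ht : t < E.T)
    {i : Fin N} (hi : i ∈ (E.round t).players) :
    ∫ ω, r t i ω ∂P = ∫ ω, meanOf (E.μ i) (m t ω i) ∂P := by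
  rw [← integral_condExp (ℱ.le t) (f := r t i)]
  exact integral_congr_ae (h.reward_mean t ht i hi)

/-- Whether a factor is added is known before the reward is drawn, and by Hoeffding's lemma an added
factor has conditional mean at most 1. The almost sure bound is carried through the induction to
give integrability and to pull the past out of the conditional expectation. -/
theorem IsACUCBRun.expReward_spec (h : E.IsACUCBRun P ℱ m r) (i : Fin N) (a : Fin K) (l : ℝ)
    (t : ℕ) (ht : t ≤ E.T) :
    Measurable[ℱ t] (E.expReward m r i a l t) ∧
      (∃ B : ℝ, ∀ᵐ ω ∂P, ‖E.expReward m r i a l t ω‖ ≤ B) ∧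
      ∫ ω, E.expReward m r i a l t ω ∂P ≤ 1 := by
  induction t with
  | zero =>
    have h0 : E.expReward m r i a l 0 = fun _ => 1 := by
      funext ω
      simp [expReward, matchRounds]
    rw [h0]
    exact ⟨measurable_const, ⟨1, by simp⟩, by simp⟩
  | succ t ih =>
    obtain ⟨hmeas, ⟨B, hB⟩, hint⟩ := ih (by omega)
    have ht' : t < E.T := by omega
    by_cases hi : i ∈ (E.round t).players
    swap
    · have heq : E.expReward m r i a l (t + 1) = E.expReward m r i a l t := by
        funext ω
        rw [expReward_succ, if_neg (by simp [hi])]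
      rw [heq]
      exact ⟨hmeas.mono (ℱ.mono t.le_succ) le_rfl, ⟨B, hB⟩, hint⟩
    set Z := E.expReward m r i a l t with hZ
    set A := {ω | m t ω i = some a} with hA
    have hAm : MeasurableSet[ℱ t] A := h.adapted_matching t ht' i a
    have hsucc : ∀ ω, E.expReward m r i a l (t + 1) ω = Aᶜ.indicator Z ω +
        A.indicator Z ω * Real.exp (l * (r t i ω - E.μ i a) - l ^ 2 / 8) := by
      intro ω
      rw [expReward_succ]
      by_cases hω : m t ω i = some a
      · have : ω ∈ A := hω
        simp [hi, hω, this, hZ]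
      · have : ω ∉ A := hω
        simp [hω, this, hZ]
    have hrm := h.adapted_reward t ht' i hi
    have hle := ℱ.mono t.le_succ
    have hZA : Measurable[ℱ t] (A.indicator Z) := hmeas.indicator hAm
    have hZAc : Measurable[ℱ t] (Aᶜ.indicator Z) := hmeas.indicator hAm.compl
    have hmeas' : Measurable[ℱ (t + 1)] (E.expReward m r i a l (t + 1)) := by
      rw [funext hsucc]
      refine (hZAc.mono hle le_rfl).add ((hZA.mono hle le_rfl).mul ?_)
      exact Real.measurable_exp.comp (((hrm.sub_const _).const_mul _).sub_const _)
    have hBA : ∀ᵐ ω ∂P, ‖A.indicator Z ω‖ ≤ B := by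
      filter_upwards [hB] with ω hω using (norm_indicator_le_norm_self Z ω).trans hω
    have hBAc : ∀ᵐ ω ∂P, ‖Aᶜ.indicator Z ω‖ ≤ B := by
      filter_upwards [hB] with ω hω using (norm_indicator_le_norm_self Z ω).trans hω
    set κ := Real.exp (-(l * E.μ i a) - l ^ 2 / 8) with hκ
    -- For a reward in `{0, 1}` the exponential is affine in the reward, so its conditional mean
    -- alone determines the expectation.
    have hlin : ∀ᵐ ω ∂P, E.expReward m r i a l (t + 1) ω =
        Aᶜ.indicator Z ω + κ * A.indicator Z ω
          + κ * (Real.exp l - 1) * (A.indicator Z ω * r t i ω) := by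
      filter_upwards [h.reward_zero_one t ht' i hi] with ω hω
      rw [hsucc]
      rcases hω with hω | hω
      · rw [hω, hκ]
        ring_nf
      · have : Real.exp (l * (1 - E.μ i a) - l ^ 2 / 8) = κ * Real.exp l := by
          rw [hκ, ← Real.exp_add]; ring_nf
        rw [hω, this]
        ring
    have hI1 : Integrable (A.indicator Z) P :=
      Integrable.of_bound (hZA.mono (ℱ.le t) le_rfl).aestronglyMeasurable B hBA
    have hI2 : Integrable (Aᶜ.indicator Z) P :=
      Integrable.of_bound (hZAc.mono (ℱ.le t) le_rfl).aestronglyMeasurable B hBAc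
    have hI3 : Integrable (fun ω => A.indicator Z ω * r t i ω) P :=
      (h.integrable_reward ht' hi).bdd_mul
        (hZA.mono (ℱ.le t) le_rfl).aestronglyMeasurable hBA
    refine ⟨hmeas', ⟨B + κ * B + |κ * (Real.exp l - 1)| * B, ?_⟩, ?_⟩
    · filter_upwards [hlin, hBA, hBAc, h.reward_zero_one t ht' i hi] with ω h1 h2 h3 h4
      have hB0 : 0 ≤ B := (norm_nonneg _).trans h2
      rw [h1]
      refine (norm_add₃_le).trans ?_
      have hr : ‖r t i ω‖ ≤ 1 := by rcases h4 with h4 | h4 <;> simp [h4]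
      have hκ0 : ‖κ‖ = κ := by rw [Real.norm_eq_abs, abs_of_pos (Real.exp_pos _)]
      gcongr
      · rw [norm_mul, hκ0]
        gcongr
      · rw [norm_mul, norm_mul (A.indicator Z ω), Real.norm_eq_abs (κ * _)]
        gcongr
        nlinarith [norm_nonneg (r t i ω), norm_nonneg (A.indicator Z ω)]
    · have hmean : ∫ ω, A.indicator Z ω * r t i ω ∂P = E.μ i a * ∫ ω, A.indicator Z ω ∂P := by
        rw [h.integral_mul_reward ht' hi hZA hBA, ← integral_const_mul]
        congr 1
        funext ω
        by_cases hω : ω ∈ A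
        · have : m t ω i = some a := hω
          simp [this, meanOf, mul_comm]
        · simp [hω]
      have hfac : κ * (1 + (Real.exp l - 1) * E.μ i a) ≤ 1 := by
        have h1 := one_add_mul_exp_sub_one_le (E.μ_pos i a).le (E.μ_lt_one i a).le l
        calc κ * (1 + (Real.exp l - 1) * E.μ i a)
            ≤ κ * Real.exp (l * E.μ i a + l ^ 2 / 8) := by
              gcongr
          _ = 1 := by rw [hκ, ← Real.exp_add]; simp
      have hnn : 0 ≤ ∫ ω, A.indicator Z ω ∂P :=
        integral_nonneg fun ω => Set.indicator_nonneg
          (fun x _ => (E.expReward_pos m r i a l t x).le) ω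
      have hsum : ∫ ω, Aᶜ.indicator Z ω ∂P + ∫ ω, A.indicator Z ω ∂P = ∫ ω, Z ω ∂P := by
        rw [← integral_add hI2 hI1]
        congr 1
        funext ω
        exact Set.indicator_compl_add_self_apply A Z ω
      have hsplit : ∫ ω, (Aᶜ.indicator Z ω + κ * A.indicator Z ω
            + κ * (Real.exp l - 1) * (A.indicator Z ω * r t i ω)) ∂P =
          ∫ ω, Aᶜ.indicator Z ω ∂P + ∫ ω, κ * A.indicator Z ω ∂P
            + ∫ ω, κ * (Real.exp l - 1) * (A.indicator Z ω * r t i ω) ∂P := by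
        rw [← integral_add hI2 (hI1.const_mul κ)]
        exact integral_add (hI2.add (hI1.const_mul κ)) (hI3.const_mul _)
      rw [integral_congr_ae hlin, hsplit, integral_const_mul, integral_const_mul, hmean]
      nlinarith

theorem IsACUCBRun.measurable_expReward (h : E.IsACUCBRun P ℱ m r) (i : Fin N) (a : Fin K)
    (l : ℝ) {t : ℕ} (ht : t ≤ E.T) : Measurable (E.expReward m r i a l t) :=
  (h.expReward_spec i a l t ht).1.mono (ℱ.le t) le_rfl

theorem IsACUCBRun.measureReal_expReward_ge_le (h : E.IsACUCBRun P ℱ m r) (i : Fin N)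
    (a : Fin K) (l : ℝ) {t : ℕ} (ht : t ≤ E.T) {x : ℝ} (hx : 0 < x) :
    P.real {ω | x ≤ E.expReward m r i a l t ω} ≤ 1 / x := by
  obtain ⟨-, ⟨B, hB⟩, h1⟩ := h.expReward_spec i a l t ht
  have h2 := mul_meas_ge_le_integral_of_nonneg
    (ae_of_all P fun ω => (E.expReward_pos m r i a l t ω).le)
    (Integrable.of_bound (h.measurable_expReward i a l ht).aestronglyMeasurable B hB) x
  rw [le_div_iff₀ hx, mul_comm]
  exact h2.trans h1

theorem IsACUCBRun.measurableSet_deviationEvent (h : E.IsACUCBRun P ℱ m r) (i : Fin N)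
    (a : Fin K) {t : ℕ} (ht : t ≤ E.T) : MeasurableSet (E.deviationEvent m r i a t) := by
  refine Finset.measurableSet_biUnion _ fun n _ => ?_
  exact (measurableSet_le measurable_const (h.measurable_expReward i a _ ht)).union
    (measurableSet_le measurable_const (h.measurable_expReward i a _ ht))

/-- With `L` the local index, Markov's inequality costs `2 / L ^ 2` for each of the `L - 1` possible
sample counts. -/
theorem IsACUCBRun.measureReal_deviationEvent_le (h : E.IsACUCBRun P ℱ m r) (i : Fin N)
    (a : Fin K) {t : ℕ} (ht : t ≤ E.T) (hpos : 0 < E.localIndex i t) :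
    P.real (E.deviationEvent m r i a t) ≤ 2 / E.localIndex i t := by
  have hpos' : (0 : ℝ) < E.localIndex i t := by exact_mod_cast hpos
  calc P.real (E.deviationEvent m r i a t)
      ≤ ∑ n ∈ Finset.Icc 1 (E.localIndex i t - 1),
          (2 / (E.localIndex i t : ℝ) ^ 2) := by
        refine (measureReal_biUnion_finset_le _ _).trans (Finset.sum_le_sum fun n _ => ?_)
        refine (measureReal_union_le _ _).trans ?_
        have h1 := h.measureReal_expReward_ge_le i a
          (4 * √(Real.log (E.localIndex i t) / n)) ht (pow_pos hpos' 2)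
        have h2 := h.measureReal_expReward_ge_le i a
          (-(4 * √(Real.log (E.localIndex i t) / n))) ht (pow_pos hpos' 2)
        calc _ ≤ _ := add_le_add h1 h2
          _ = _ := by ring
    _ = ((E.localIndex i t - 1 : ℕ) : ℝ) * (2 / (E.localIndex i t : ℝ) ^ 2) := by simp
    _ ≤ (E.localIndex i t : ℝ) * (2 / (E.localIndex i t : ℝ) ^ 2) := by
        gcongr
        omega
    _ = 2 / E.localIndex i t := by field_simp

end Environment

end SleepingBandits

end

/-! ### Counting the rounds with a misranked arm -/

noncomputable section

namespace SleepingBandits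

theorem meanOf_le_one {N K : ℕ} (E : Environment N K) (i : Fin N) (o : Option (Fin K)) :
    meanOf (E.μ i) o ≤ 1 := by
  cases o with
  | none => simp [meanOf]
  | some a => exact (E.μ_lt_one i a).le

theorem meanOf_nonneg {N K : ℕ} (E : Environment N K) (i : Fin N) (o : Option (Fin K)) :
    0 ≤ meanOf (E.μ i) o := by
  cases o with
  | none => simp [meanOf]
  | some a => exact (E.μ_pos i a).le

namespace Environment

variable {N K : ℕ} {E : Environment N K}

theorem mem_availRounds {i : Fin N} {t : ℕ} :
    t ∈ E.availRounds i ↔ t < E.T ∧ i ∈ (E.round t).players := by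
  simp [availRounds]

theorem localIndex_le_numRounds {t : ℕ} (ht : t < E.T) (i : Fin N) :
    E.localIndex i t ≤ E.numRounds i := by
  refine Finset.card_le_card fun s hs => ?_
  simp only [Finset.mem_filter, Finset.mem_range, mem_availRounds] at hs ⊢
  exact ⟨by omega, hs.2⟩

theorem localIndex_lt_localIndex {s t : ℕ} {i : Fin N} (hst : s < t)
    (hi : i ∈ (E.round t).players) : E.localIndex i s < E.localIndex i t := by
  refine Finset.card_lt_card ⟨fun u hu => ?_, fun hsub => ?_⟩
  · simp only [Finset.mem_filter, Finset.mem_range] at hu ⊢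
    exact ⟨by omega, hu.2⟩
  · have := hsub (Finset.mem_filter.2 ⟨Finset.mem_range.2 t.lt_succ_self, hi⟩)
    simp only [Finset.mem_filter, Finset.mem_range] at this
    omega

theorem localIndex_pos {t : ℕ} {i : Fin N} (hi : i ∈ (E.round t).players) :
    0 < E.localIndex i t :=
  Finset.card_pos.2 ⟨t, by simp [hi]⟩

/-- The local indices of distinct rounds of `i` are distinct numbers in `{1, …, T_i}`, so a harmonic
sum dominates. -/
theorem sum_inv_localIndex_le (i : Fin N) :
    ∑ t ∈ E.availRounds i, ((E.localIndex i t : ℝ))⁻¹ ≤ 1 + Real.log (E.numRounds i) := by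
  have hinj : Set.InjOn (E.localIndex i) (E.availRounds i) := by
    intro s hs t ht hst
    have hs' := (mem_availRounds.1 hs).2
    have ht' := (mem_availRounds.1 ht).2
    rcases lt_trichotomy s t with h | h | h
    · exact absurd hst (localIndex_lt_localIndex h ht').ne
    · exact h
    · exact absurd hst (localIndex_lt_localIndex h hs').ne'
  calc ∑ t ∈ E.availRounds i, ((E.localIndex i t : ℝ))⁻¹
      = ∑ k ∈ (E.availRounds i).image (E.localIndex i), (k : ℝ)⁻¹ :=
        (Finset.sum_image (f := fun k : ℕ => (k : ℝ)⁻¹) hinj).symm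
    _ ≤ ∑ k ∈ Finset.Icc 1 (E.numRounds i), (k : ℝ)⁻¹ := by
        refine Finset.sum_le_sum_of_subset_of_nonneg ?_ fun _ _ _ => by positivity
        intro k hk
        obtain ⟨t, ht, rfl⟩ := Finset.mem_image.1 hk
        have ht' := mem_availRounds.1 ht
        exact Finset.mem_Icc.2 ⟨localIndex_pos ht'.2, localIndex_le_numRounds ht'.1 i⟩
    _ ≤ 1 + Real.log (E.numRounds i) := by
        refine le_trans (le_of_eq ?_) (harmonic_le_one_add_log _)
        simp [harmonic_eq_sum_Icc]

theorem minGap_le {t : ℕ} (ht : t < E.T) {i : Fin N} (hi : i ∈ (E.round t).players)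
    {a b : Fin K} (ha : a ∈ (E.round t).arms) (hb : b ∈ (E.round t).arms) (hab : a ≠ b) :
    E.minGap ≤ |E.μ i a - E.μ i b| := by
  refine csInf_le ⟨0, ?_⟩ ⟨t, ht, i, hi, a, ha, b, hb, hab, rfl⟩
  rintro d ⟨-, -, -, -, -, -, -, -, -, rfl⟩
  exact abs_nonneg _

/-- Only finitely many gaps occur, so the infimum is attained, and no attained gap vanishes. -/
theorem minGap_pos {t : ℕ} (ht : t < E.T) {i : Fin N} (hi : i ∈ (E.round t).players)
    {a b : Fin K} (ha : a ∈ (E.round t).arms) (hb : b ∈ (E.round t).arms) (hab : a ≠ b) :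
    0 < E.minGap := by
  have hmem := Set.Nonempty.csInf_mem (s := {d : ℝ | ∃ t < E.T, ∃ i ∈ (E.round t).players,
    ∃ a ∈ (E.round t).arms, ∃ b ∈ (E.round t).arms, a ≠ b ∧ d = |E.μ i a - E.μ i b|})
    ⟨_, t, ht, i, hi, a, ha, b, hb, hab, rfl⟩
    ((Set.finite_range fun x : Fin N × Fin K × Fin K =>
      |E.μ x.1 x.2.1 - E.μ x.1 x.2.2|).subset (by
        rintro d ⟨-, -, i, -, a, -, b, -, -, rfl⟩
        exact ⟨(i, a, b), rfl⟩))
  obtain ⟨t, ht, i, hi, a, ha, b, hb, hab, hd⟩ := hmem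
  rw [minGap, hd]
  exact abs_pos.2 (sub_ne_zero.2 (E.μ_distinct t ht i hi a ha b hb hab))

variable {Ω : Type*} {m : ℕ → Ω → Assignment N K} {r : ℕ → Fin N → Ω → ℝ}

theorem count_lt_count (i : Fin N) (a : Fin K) (ω : Ω) {s t : ℕ} (hst : s < t)
    (hi : i ∈ (E.round s).players) (hs : m s ω i = some a) :
    E.count m i a s ω < E.count m i a t ω := by
  refine Finset.card_lt_card ⟨fun u hu => ?_, fun hsub => ?_⟩
  · simp only [matchRounds, Finset.mem_filter, Finset.mem_range] at hu ⊢
    exact ⟨by omega, hu.2⟩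
  · have : s ∈ E.matchRounds m i a t ω := by simp [matchRounds, hst, hi, hs]
    exact E.notMem_matchRounds m i a s ω (hsub this)

variable (E) in
/-- The rounds in which player `i` is matched to arm `a` having been matched to it at most `x`
times before. -/
def rareRounds (m : ℕ → Ω → Assignment N K) (x : ℝ) (i : Fin N) (a : Fin K) (ω : Ω) :
    Finset ℕ :=
  (E.availRounds i).filter fun t => m t ω i = some a ∧ (E.count m i a t ω : ℝ) ≤ x

/-- Each match raises the count, so distinct rare rounds have distinct counts in `{0, …, ⌊x⌋}`. -/
theorem card_rareRounds_le {x : ℝ} (hx : 0 ≤ x) (i : Fin N) (a : Fin K) (ω : Ω) :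
    ((E.rareRounds m x i a ω).card : ℝ) ≤ x + 1 := by
  have h : (E.rareRounds m x i a ω).card ≤ (Finset.range (⌊x⌋₊ + 1)).card := by
    refine Finset.card_le_card_of_injOn (fun t => E.count m i a t ω) ?_ ?_
    · intro t ht
      simp only [rareRounds, Finset.coe_filter, Set.mem_ofPred_eq] at ht
      simpa [Nat.lt_succ_iff] using Nat.le_floor ht.2.2
    · intro s hs t ht hst
      simp only [rareRounds, Finset.coe_filter, Set.mem_ofPred_eq, mem_availRounds] at hs ht
      rcases lt_trichotomy s t with h | h | h
      · exact absurd hst (count_lt_count i a ω h hs.1.2 hs.2.1).ne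
      · exact h
      · exact absurd hst (count_lt_count i a ω h ht.1.2 ht.2.1).ne'
  rw [Finset.card_range] at h
  calc ((E.rareRounds m x i a ω).card : ℝ) ≤ ((⌊x⌋₊ + 1 : ℕ) : ℝ) := by exact_mod_cast h
    _ ≤ x + 1 := by
      push_cast
      linarith [Nat.floor_le hx]

/-- If a player ranks arm `b` above a better arm `a`, then one of the confidence intervals fails
or `b` has been sampled rarely. -/
theorem rare_or_deviation {t : ℕ} (ht : t < E.T) {i : Fin N} (hi : i ∈ (E.round t).players)
    {a b : Fin K} (ha : a ∈ (E.round t).arms) (hb : b ∈ (E.round t).arms) {ω : Ω}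
    (hlt : E.μ i b < E.μ i a) (hucb : E.ucb m r i a t ω ≤ E.ucb m r i b t ω) :
    (E.count m i b t ω : ℝ) ≤ 4 * Real.log (E.numRounds i) / E.minGap ^ 2 ∨
      ω ∈ E.deviationEvent m r i a t ∨ ω ∈ E.deviationEvent m r i b t := by
  have hab : a ≠ b := by rintro rfl; exact lt_irrefl _ hlt
  have hgap := minGap_pos ht hi ha hb hab
  have hgap' := minGap_le ht hi ha hb hab
  rw [abs_of_pos (sub_pos.2 hlt)] at hgap'
  have hL : (E.localIndex i t : ℝ) ≤ E.numRounds i := by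
    exact_mod_cast localIndex_le_numRounds ht i
  have hL1 : (1 : ℝ) ≤ E.localIndex i t := by exact_mod_cast localIndex_pos hi
  have hlog : 0 ≤ Real.log (E.localIndex i t) := Real.log_nonneg hL1
  have hlog' : Real.log (E.localIndex i t) ≤ Real.log (E.numRounds i) :=
    Real.log_le_log (by linarith) hL
  by_cases hb0 : E.count m i b t ω = 0
  · left
    rw [hb0, Nat.cast_zero]
    have := hlog.trans hlog'
    positivity
  by_contra! hcon
  obtain ⟨hcount, hda, hdb⟩ := hcon
  -- An unsampled `a` would have index `⊤`, above the finite index of `b`.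
  have ha0 : E.count m i a t ω ≠ 0 := by
    intro ha0
    rw [ucb, ucb, if_pos ha0, if_neg hb0, top_le_iff] at hucb
    exact EReal.coe_ne_top _ hucb
  rw [ucb, ucb, if_neg ha0, if_neg hb0, EReal.coe_le_coe_iff] at hucb
  have h1 := (abs_le.1 (E.abs_empMean_sub_le hi ha0 hda)).1
  have h2 := (abs_le.1 (E.abs_empMean_sub_le hi hb0 hdb)).2
  -- `μ a` is at most the index of `a`, hence at most that of `b`, which exceeds `μ b` by at most
  -- twice the radius of `b`.
  have h3 : E.minGap ≤ 2 * √(Real.log (E.localIndex i t) / E.count m i b t ω) := by linarith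
  have hn : (0 : ℝ) < E.count m i b t ω := by exact_mod_cast Nat.pos_of_ne_zero hb0
  have h4 : E.minGap ^ 2 ≤ 4 * (Real.log (E.localIndex i t) / E.count m i b t ω) := by
    calc E.minGap ^ 2 ≤ (2 * √(Real.log (E.localIndex i t) / E.count m i b t ω)) ^ 2 := by
          gcongr
      _ = _ := by rw [mul_pow, Real.sq_sqrt (by positivity)]; norm_num
  rw [div_lt_iff₀ (by positivity)] at hcount
  rw [← mul_div_assoc, le_div_iff₀ hn] at h4
  nlinarith

/-! ### From unstable rounds to the regret -/

variable [MeasurableSpace Ω] {P : Measure Ω} {ℱ : Filtration ℕ ‹MeasurableSpace Ω›}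
  {mPess : ℕ → Assignment N K}

/-- A round whose matching is not stable has a player who is matched to an arm that is worse than
another available arm with a smaller UCB index. -/
theorem IsACUCBRun.exists_of_not_isStable (h : E.IsACUCBRun P ℱ m r) {t : ℕ} (ht : t < E.T)
    {ω : Ω} (hst : ¬ (E.round t).IsStable E.μ (m t ω)) :
    ∃ i ∈ (E.round t).players, ∃ a ∈ (E.round t).arms, ∃ b ∈ (E.round t).arms,
      m t ω i = some b ∧ E.μ i b < E.μ i a ∧ E.ucb m r i a t ω ≤ E.ucb m r i b t ω := by
  obtain ⟨σ, hσ, hout⟩ := h.gale_shapley t ht ω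
  rw [Round.IsStable] at hst
  push Not at hst
  obtain ⟨i, a, hblock⟩ := hst hout.isMatching
  obtain ⟨b, hb, hm, hlt, hμ⟩ := hout.exists_of_isBlockingPair hblock
  exact ⟨i, hblock.1, a, hblock.2.1, b, hb, hm, hμ, hσ i hblock.1 b hb a hblock.2.1 hlt⟩

/-- An unstable round costs at most 1 and makes some term on the right at least 1. The player at
fault need not be `i`, hence the sum over all `j`. -/
theorem IsACUCBRun.meanOf_sub_le (h : E.IsACUCBRun P ℱ m r)
    (hP : ∀ t < E.T, (E.round t).IsPlayerPessimal E.μ (mPess t)) {t : ℕ} (ht : t < E.T)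
    {i : Fin N} (hi : i ∈ (E.round t).players) (ω : Ω) :
    meanOf (E.μ i) (mPess t i) - meanOf (E.μ i) (m t ω i) ≤
      ∑ j, ∑ a, ((if t ∈ E.rareRounds m (4 * Real.log (E.numRounds j) / E.minGap ^ 2) j a ω
          then 1 else 0) +
        if t ∈ E.availRounds j then (E.deviationEvent m r j a t).indicator 1 ω else 0) := by
  have hnn : ∀ j a, (0 : ℝ) ≤
      (if t ∈ E.rareRounds m (4 * Real.log (E.numRounds j) / E.minGap ^ 2) j a ω
          then 1 else 0) +
        if t ∈ E.availRounds j then (E.deviationEvent m r j a t).indicator 1 ω else 0 := by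
    intro j a
    have : (0 : ℝ) ≤ (E.deviationEvent m r j a t).indicator 1 ω :=
      Set.indicator_nonneg (fun _ _ => zero_le_one) ω
    split_ifs <;> linarith
  by_cases hst : (E.round t).IsStable E.μ (m t ω)
  · have := (hP t ht).2 _ hst i hi
    exact (sub_nonpos.2 this).trans
      (Finset.sum_nonneg fun j _ => Finset.sum_nonneg fun a _ => hnn j a)
  · obtain ⟨j, hj, a, ha, b, hb, hm, hμ, hucb⟩ := h.exists_of_not_isStable ht hst
    have hone : ∃ c, (1 : ℝ) ≤
        (if t ∈ E.rareRounds m (4 * Real.log (E.numRounds j) / E.minGap ^ 2) j c ω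
          then 1 else 0) +
        if t ∈ E.availRounds j then (E.deviationEvent m r j c t).indicator 1 ω else 0 := by
      have hav : t ∈ E.availRounds j := mem_availRounds.2 ⟨ht, hj⟩
      rcases rare_or_deviation ht hj ha hb hμ hucb with h1 | h1 | h1
      · refine ⟨b, ?_⟩
        have hr : t ∈ E.rareRounds m (4 * Real.log (E.numRounds j) / E.minGap ^ 2) j b ω := by
          simp only [rareRounds, Finset.mem_filter]
          exact ⟨hav, hm, h1⟩
        rw [if_pos hr, if_pos hav]
        have : (0 : ℝ) ≤ (E.deviationEvent m r j b t).indicator 1 ω :=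
          Set.indicator_nonneg (fun _ _ => zero_le_one) ω
        linarith
      · refine ⟨a, ?_⟩
        rw [if_pos hav, Set.indicator_of_mem h1]
        split_ifs <;> simp
      · refine ⟨b, ?_⟩
        rw [if_pos hav, Set.indicator_of_mem h1]
        split_ifs <;> simp
    obtain ⟨c, hc⟩ := hone
    refine le_trans ?_ (hc.trans ((Finset.single_le_sum (fun c _ => hnn j c)
      (Finset.mem_univ c)).trans (Finset.single_le_sum
        (f := fun j => ∑ a, ((if t ∈ E.rareRounds m
          (4 * Real.log (E.numRounds j) / E.minGap ^ 2) j a ω then (1 : ℝ) else 0) +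
          if t ∈ E.availRounds j then (E.deviationEvent m r j a t).indicator 1 ω else 0))
        (fun j _ => Finset.sum_nonneg fun a _ => hnn j a) (Finset.mem_univ j))))
    linarith [meanOf_le_one E i (mPess t i), meanOf_nonneg E i (m t ω i)]

theorem IsACUCBRun.sum_meanOf_sub_le (h : E.IsACUCBRun P ℱ m r)
    (hP : ∀ t < E.T, (E.round t).IsPlayerPessimal E.μ (mPess t)) (i : Fin N) (ω : Ω) :
    ∑ t ∈ E.availRounds i, (meanOf (E.μ i) (mPess t i) - meanOf (E.μ i) (m t ω i)) ≤
      ∑ j, ∑ _a : Fin K, (4 * Real.log (E.numRounds j) / E.minGap ^ 2 + 1) +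
        ∑ j, ∑ a, ∑ t ∈ E.availRounds j, (E.deviationEvent m r j a t).indicator 1 ω := by
  set F : ℕ → Fin N → Fin K → ℝ := fun t j a =>
    (if t ∈ E.rareRounds m (4 * Real.log (E.numRounds j) / E.minGap ^ 2) j a ω
          then 1 else 0) +
        if t ∈ E.availRounds j then (E.deviationEvent m r j a t).indicator 1 ω else 0 with hF
  have hnn : ∀ t j a, 0 ≤ F t j a := by
    intro t j a
    have : (0 : ℝ) ≤ (E.deviationEvent m r j a t).indicator 1 ω :=
      Set.indicator_nonneg (fun _ _ => zero_le_one) ω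
    simp only [hF]
    split_ifs <;> linarith
  calc _ ≤ ∑ t ∈ E.availRounds i, ∑ j, ∑ a, F t j a :=
        Finset.sum_le_sum fun t ht => h.meanOf_sub_le hP (mem_availRounds.1 ht).1
          (mem_availRounds.1 ht).2 ω
    -- Passing to all rounds lets the charges of each `j` be counted over its own available rounds.
    _ ≤ ∑ t ∈ Finset.range E.T, ∑ j, ∑ a, F t j a :=
        Finset.sum_le_sum_of_subset_of_nonneg (Finset.filter_subset _ _) fun t _ _ =>
          Finset.sum_nonneg fun j _ => Finset.sum_nonneg fun a _ => hnn t j a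
    _ = ∑ j, ∑ a, ∑ t ∈ Finset.range E.T, F t j a := by
        rw [Finset.sum_comm]
        exact Finset.sum_congr rfl fun j _ => Finset.sum_comm
    _ ≤ ∑ j, ∑ a, ((4 * Real.log (E.numRounds j) / E.minGap ^ 2 + 1) +
          ∑ t ∈ E.availRounds j, (E.deviationEvent m r j a t).indicator 1 ω) := by
        refine Finset.sum_le_sum fun j _ => Finset.sum_le_sum fun a _ => ?_
        have hav : E.availRounds j ⊆ Finset.range E.T := Finset.filter_subset _ _
        have hrare : E.rareRounds m (4 * Real.log (E.numRounds j) / E.minGap ^ 2) j a ω ⊆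
            Finset.range E.T := (Finset.filter_subset _ _).trans hav
        simp only [hF]
        rw [Finset.sum_add_distrib, Finset.sum_ite_mem, Finset.sum_ite_mem,
          Finset.inter_eq_right.2 hav, Finset.inter_eq_right.2 hrare]
        simp only [Finset.sum_const, nsmul_eq_mul, mul_one]
        gcongr
        refine card_rareRounds_le ?_ j a ω
        have := Real.log_natCast_nonneg (E.numRounds j)
        positivity
    _ = _ := by simp only [Finset.sum_add_distrib]

variable [IsProbabilityMeasure P]

theorem IsACUCBRun.integrable_meanOf (h : E.IsACUCBRun P ℱ m r) {t : ℕ} (ht : t < E.T)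
    (i : Fin N) : Integrable (fun ω => meanOf (E.μ i) (m t ω i)) P := by
  have heq : (fun ω => meanOf (E.μ i) (m t ω i)) =
      fun ω => ∑ a, {ω | m t ω i = some a}.indicator (fun _ => E.μ i a) ω := by
    funext ω
    cases hm : m t ω i with
    | none => simp [meanOf, hm]
    | some a => simp [meanOf, Set.indicator_apply, hm]
  rw [heq]
  exact integrable_finsetSum _ fun a _ => (integrable_const _).indicator
    (ℱ.le t _ (h.adapted_matching t ht i a))

/-- Replacing rewards by their conditional means makes the integrand amenable to a bound for every
outcome. -/
theorem IsACUCBRun.pessimalRegret_eq (h : E.IsACUCBRun P ℱ m r) (i : Fin N) :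
    E.pessimalRegret P mPess r i = ∫ ω, ∑ t ∈ E.availRounds i,
      (meanOf (E.μ i) (mPess t i) - meanOf (E.μ i) (m t ω i)) ∂P := by
  rw [integral_finsetSum]
  · refine Finset.sum_congr rfl fun t ht => ?_
    have ht' := mem_availRounds.1 ht
    rw [integral_sub (integrable_const _) (h.integrable_meanOf ht'.1 i),
      h.integral_reward ht'.1 ht'.2]
    simp
  · intro t ht
    exact (integrable_const _).sub (h.integrable_meanOf (mem_availRounds.1 ht).1 i)

theorem IsACUCBRun.pessimalRegret_le (h : E.IsACUCBRun P ℱ m r)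
    (hP : ∀ t < E.T, (E.round t).IsPlayerPessimal E.μ (mPess t)) (i : Fin N) :
    E.pessimalRegret P mPess r i ≤
      ∑ j, ∑ _a : Fin K, (4 * Real.log (E.numRounds j) / E.minGap ^ 2 + 1 +
        2 * (1 + Real.log (E.numRounds j))) := by
  have hdev : ∀ j a, ∀ t ∈ E.availRounds j,
      Integrable ((E.deviationEvent m r j a t).indicator (1 : Ω → ℝ)) P := fun j a t ht =>
    (integrable_const (1 : ℝ)).indicator
      (h.measurableSet_deviationEvent j a (mem_availRounds.1 ht).1.le)
  have hdev1 : ∀ j a, Integrable (fun ω => ∑ t ∈ E.availRounds j,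
      (E.deviationEvent m r j a t).indicator (1 : Ω → ℝ) ω) P := fun j a =>
    integrable_finsetSum _ (hdev j a)
  have hdev2 : ∀ j, Integrable (fun ω => ∑ a, ∑ t ∈ E.availRounds j,
      (E.deviationEvent m r j a t).indicator (1 : Ω → ℝ) ω) P := fun j =>
    integrable_finsetSum _ fun a _ => hdev1 j a
  rw [h.pessimalRegret_eq]
  refine (integral_mono (integrable_finsetSum _ fun t ht =>
    (integrable_const _).sub (h.integrable_meanOf (mem_availRounds.1 ht).1 i))
    ((integrable_const _).add (integrable_finsetSum _ fun j _ => hdev2 j))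
    (h.sum_meanOf_sub_le hP i)).trans ?_
  simp only [Pi.add_apply]
  rw [integral_add (integrable_const _) (integrable_finsetSum _ fun j _ => hdev2 j),
    integral_finsetSum _ fun j _ => hdev2 j]
  rw [integral_const, probReal_univ, one_smul, ← Finset.sum_add_distrib]
  refine Finset.sum_le_sum fun j _ => ?_
  rw [integral_finsetSum _ fun a _ => hdev1 j a, ← Finset.sum_add_distrib]
  refine Finset.sum_le_sum fun a _ => ?_
  gcongr
  rw [integral_finsetSum _ (hdev j a)]
  calc ∑ t ∈ E.availRounds j, ∫ ω, (E.deviationEvent m r j a t).indicator (1 : Ω → ℝ) ω ∂P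
      ≤ ∑ t ∈ E.availRounds j, 2 * ((E.localIndex j t : ℝ))⁻¹ := by
        refine Finset.sum_le_sum fun t ht => ?_
        have ht' := mem_availRounds.1 ht
        rw [integral_indicator_one (h.measurableSet_deviationEvent j a ht'.1.le),
          ← div_eq_mul_inv]
        exact h.measureReal_deviationEvent_le j a ht'.1.le (localIndex_pos ht'.2)
    _ ≤ 2 * (1 + Real.log (E.numRounds j)) := by
        rw [← Finset.mul_sum]
        gcongr
        exact sum_inv_localIndex_le j

/-- Without two distinct arms that are available together, there is no regret. -/
theorem IsACUCBRun.pessimalRegret_nonpos (h : E.IsACUCBRun P ℱ m r)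
    (hP : ∀ t < E.T, (E.round t).IsPlayerPessimal E.μ (mPess t))
    (harms : ∀ t < E.T, ∀ i ∈ (E.round t).players, ∀ a ∈ (E.round t).arms,
      ∀ b ∈ (E.round t).arms, a = b) (i : Fin N) :
    E.pessimalRegret P mPess r i ≤ 0 := by
  rw [h.pessimalRegret_eq]
  refine integral_nonpos fun ω => Finset.sum_nonpos fun t ht => ?_
  have ht' := mem_availRounds.1 ht
  refine sub_nonpos.2 ((hP t ht'.1).2 _ ?_ i ht'.2)
  by_contra hst
  obtain ⟨j, hj, a, ha, b, hb, -, hμ, -⟩ := h.exists_of_not_isStable ht'.1 hst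
  rw [harms t ht'.1 j hj a ha b hb] at hμ
  exact lt_irrefl _ hμ

end Environment

end SleepingBandits

end

/-! ### The constant -/

theorem theorem3 (c₁ c₂ : ℝ) :
    ∃ C : ℝ, 0 < C ∧
      ∀ (N K : ℕ) (E : SleepingBandits.Environment N K)
        (Ω : Type*) [MeasurableSpace Ω]
        (P : MeasureTheory.Measure Ω) [MeasureTheory.IsProbabilityMeasure P]
        (ℱ : MeasureTheory.Filtration ℕ ‹MeasurableSpace Ω›)
        (m : ℕ → Ω → SleepingBandits.Assignment N K) (r : ℕ → Fin N → Ω → ℝ)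
        (mPess : ℕ → SleepingBandits.Assignment N K),
        E.IsACUCBRun P ℱ m r →
        (∀ t < E.T, (E.round t).IsPlayerPessimal E.μ (mPess t)) →
        (∀ i j : Fin N, (E.numRounds i : ℝ) ≤ c₁ * (E.numRounds j : ℝ)) →
        ∀ i : Fin N, (K : ℝ) ≤ c₂ * Real.log (E.numRounds i : ℝ) →
          E.pessimalRegret P mPess r i ≤
            C * ((N : ℝ) * (K : ℝ) * Real.log (E.numRounds i : ℝ) / E.minGap ^ 2) := by
  refine ⟨6 * (1 + 2 * |Real.log c₁|) + 6, by positivity, ?_⟩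
  intro N K E Ω _ P _ ℱ m r mPess h hP hc i hK
  have hln0 : 0 ≤ Real.log (E.numRounds i) := Real.log_natCast_nonneg _
  by_cases harms : ∀ t < E.T, ∀ i ∈ (E.round t).players, ∀ a ∈ (E.round t).arms,
      ∀ b ∈ (E.round t).arms, a = b
  -- Here `minGap` is `sInf ∅ = 0` and the right-hand side is `0`, so the regret must be shown
  -- nonpositive.
  · exact (h.pessimalRegret_nonpos hP harms i).trans (by positivity)
  push Not at harms
  obtain ⟨t, ht, p, hp, a, ha, b, hb, hab⟩ := harms
  have hgap : 0 < E.minGap := SleepingBandits.Environment.minGap_pos ht hp ha hb hab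
  have hgap1 : E.minGap ≤ 1 := by
    refine (SleepingBandits.Environment.minGap_le ht hp ha hb hab).trans (abs_le.2 ⟨?_, ?_⟩) <;>
      linarith [E.μ_pos p a, E.μ_pos p b, E.μ_lt_one p a, E.μ_lt_one p b]
  refine (h.pessimalRegret_le hP i).trans ?_
  have hterm : ∀ j : Fin N, 4 * Real.log (E.numRounds j) / E.minGap ^ 2 + 1 +
      2 * (1 + Real.log (E.numRounds j)) ≤
        (6 * (1 + 2 * |Real.log c₁|) + 6) * (Real.log (E.numRounds i) / E.minGap ^ 2) := by
    intro j
    have hK0 : (0 : ℝ) < K := by exact_mod_cast Fin.pos a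
    -- An arm exists, so `0 < K ≤ c₂ log T_i` forces `T_i ≥ 2` and `log T_i ≥ 1/2`: constants can be
    -- absorbed into the logarithm.
    have hne : Real.log (E.numRounds i) ≠ 0 := fun h0 => by
      rw [h0, mul_zero] at hK
      exact hK.not_gt hK0
    have hn : 2 ≤ E.numRounds i := by
      by_contra! hlt
      interval_cases hn : E.numRounds i <;> simp at hne
    have hn' : (2 : ℝ) ≤ E.numRounds i := by exact_mod_cast hn
    have hhalf : 1 / 2 ≤ Real.log (E.numRounds i) := by
      have := Real.log_le_log (by norm_num) hn'
      linarith [Real.log_two_gt_d9]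
    have hc1 : 1 ≤ c₁ := by
      have := hc i i
      nlinarith
    have hlog : Real.log (E.numRounds j) ≤
        (1 + 2 * |Real.log c₁|) * Real.log (E.numRounds i) := by
      -- A player who is never available has `Real.log 0 = 0`.
      rcases Nat.eq_zero_or_pos (E.numRounds j) with h0 | h0
      · rw [h0, Nat.cast_zero, Real.log_zero]
        positivity
      · have h1 := Real.log_le_log (by exact_mod_cast h0) (hc j i)
        rw [Real.log_mul (by linarith) (by linarith)] at h1
        nlinarith [le_abs_self (Real.log c₁), abs_nonneg (Real.log c₁)]
    have hlj : 0 ≤ Real.log (E.numRounds j) := Real.log_natCast_nonneg _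
    have hsq : E.minGap ^ 2 ≤ 1 := pow_le_one₀ hgap.le hgap1
    rw [add_assoc, ← mul_div_assoc, div_add' _ _ _ (by positivity)]
    gcongr
    -- Since `Δ ≤ 1`, the terms without `1 / Δ²` may be given that factor, leaving `6 log T_j + 3`,
    -- and `3 ≤ 6 log T_i`.
    nlinarith [mul_nonneg (sub_nonneg.2 hsq)
      (by positivity : 0 ≤ 1 + 2 * (1 + Real.log (E.numRounds j)))]
  calc ∑ j, ∑ _a : Fin K, (4 * Real.log (E.numRounds j) / E.minGap ^ 2 + 1 +
        2 * (1 + Real.log (E.numRounds j)))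
      ≤ ∑ _j : Fin N, ∑ _a : Fin K, (6 * (1 + 2 * |Real.log c₁|) + 6) *
          (Real.log (E.numRounds i) / E.minGap ^ 2) :=
        Finset.sum_le_sum fun j _ => Finset.sum_le_sum fun _ _ => hterm j
    _ = _ := by
        simp only [Finset.sum_const, Finset.card_univ, Fintype.card_fin, nsmul_eq_mul]
        ring
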